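/- **Definitions.** Let $\mathcal C=\{0,1\}^{\mathbb N}$ be the Cantor set with its product topology and Borel $\sigma$-algebra, and let $\nu$ be the uniform probability measure on $\mathcal C$ (the product of the uniform measures on $\{0,1\}$). Let $k\ge 1$ be an integer. For a real $n\times n$ matrix $S$ put $\gamma(S)=\sum_{x,y}S_{x,y}$, and let $$C(S,k)=\{MSM^{T} : M\in\mathcal K(k,n)\}\subset\mathbb R^{k\times k},$$ where $\mathcal K(k,n)$ is the set of nonnegative $k\times n$ matrices with every row sum equal to $n/k$ and every column sum equal to $1$. For a finite Borel measure $\mu$ on $\mathcal C\times\mathcal C$, let $C_0(\mu,k)$ be the set of all $k\times k$ matrices with entries $$\int_{\mathcal C\times\mathcal C} f_i(x)f_j(y)\,d\mu(x,y)\qquad(1\le i,j\le k),$$ where $f_1,\dots,f_k$ range over all $k$-tuples of nonnegative Borel functions on $\mathcal C$ with $f_1+\dots+f_k=1$ everywhere and $\int_{\mathcal C} f_i\,d\nu=1/k$ for every $i$. Let $C(\mu,k)$ be the topological closure of $C_0(\mu,k)$ in $\mathbb R^{k\times k}$. A sequence $(S_i)_{i\ge1}$ of nonnegative square matrices (whose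 sizes may vary with $i$) is called convergent if there is a constant $c>0$ with $\gamma(S_i)<c$ for all $i$ and, for every integer $k\ge1$, the sets $C(S_i,k)$ converge to a closed subset of $[0,c]^{k\times k}$ in the Hausdorff distance induced by the $\ell_1$ norm of $\mathbb R^{k\times k}$. This closed set is unique and is called the limit shape of $C(S_i,k)$. **Theorem.** If $(S_i)_{i\ge1}$ is a convergent sequence of nonnegative symmetric matrices, then there exists a finite Borel measure $\mu$ on $\mathcal C\times\mathcal C$, symmetric in the sense that it is invariant under $(x,y)\mapsto(y,x)$, such that for every integer $k\ge 1$ the limit shape of $C(S_i,k)$ is $C(\mu,k)$. -/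

import Mathlib

open MeasureTheory Filter Topology

noncomputable section

namespace SparseShape

/-- The Cantor set `{0,1}^ℕ`, with the product topology and its Borel σ-algebra
(which is the product σ-algebra). -/
abbrev Cantor : Type := ℕ → Bool

/-- The uniform probability measure on the Cantor set: the infinite product of the uniform
measures on `{0,1}`. -/
def cantorMeasure : Measure Cantor :=
  Measure.infinitePi (fun _ : ℕ => (PMF.uniformOfFintype Bool).toMeasure)

/-- The sum of all entries of a matrix. -/
def entrySum {n : ℕ} (S : Matrix (Fin n) (Fin n) ℝ) : ℝ := ∑ x, ∑ y, S x y

/-- The nonnegative `k × n` matrices with every row sum equal to `n / k` and every column sum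
equal to `1`: the characteristic matrices of balanced fractional partitions. -/
def fractionalPartitions (k n : ℕ) : Set (Matrix (Fin k) (Fin n) ℝ) :=
  {M | (∀ i x, 0 ≤ M i x) ∧ (∀ i, ∑ x, M i x = (n : ℝ) / (k : ℝ)) ∧ (∀ x, ∑ i, M i x = 1)}

/-- The `k`-shape of an `n × n` matrix: all matrices `M S Mᵀ` with `M` a balanced fractional
partition of the index set into `k` parts. -/
def matrixShape {n : ℕ} (S : Matrix (Fin n) (Fin n) ℝ) (k : ℕ) :
    Set (Matrix (Fin k) (Fin k) ℝ) :=
  {X | ∃ M ∈ fractionalPartitions k n, X = M * S * M.transpose}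

/-- Balanced fractional partitions of the Cantor set into `k` parts: `k` nonnegative measurable
functions with sum constant `1`, each of integral `1 / k`. -/
def IsFractionalPartition {k : ℕ} (f : Fin k → Cantor → ℝ) : Prop :=
  (∀ i, Measurable (f i)) ∧ (∀ i x, 0 ≤ f i x) ∧ (∀ x, ∑ i, f i x = 1) ∧
    ∀ i, ∫ x, f i x ∂cantorMeasure = 1 / (k : ℝ)

/-- The matrix of `μ` with respect to the functions `f 0, …, f (k - 1)`, with entries
`∫ f i (x) * f j (y) dμ(x, y)`. -/
def factorMatrix {k : ℕ} (μ : Measure (Cantor × Cantor)) (f : Fin k → Cantor → ℝ) :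
    Matrix (Fin k) (Fin k) ℝ :=
  Matrix.of fun i j => ∫ p, f i p.1 * f j p.2 ∂μ

/-- The `k`-shape of a measure on the square of the Cantor set: the topological closure of the set
of all its factor matrices over balanced fractional partitions into `k` parts. -/
def measureShape (μ : Measure (Cantor × Cantor)) (k : ℕ) : Set (Matrix (Fin k) (Fin k) ℝ) :=
  closure {X | ∃ f : Fin k → Cantor → ℝ, IsFractionalPartition f ∧ X = factorMatrix μ f}

/-- A real `k × k` matrix viewed as a vector of `ℝ^(k × k)` with the `ℓ¹` norm. -/
def toL1 {k : ℕ} (X : Matrix (Fin k) (Fin k) ℝ) : PiLp 1 (fun _ : Fin k × Fin k => ℝ) :=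
  WithLp.toLp 1 (fun p => X p.1 p.2)

/-- The (extended) Hausdorff distance of two sets of `k × k` matrices induced by the `ℓ¹` norm.
It is finite on nonempty bounded sets, and infinite if exactly one of the sets is empty. -/
def shapeDist {k : ℕ} (A B : Set (Matrix (Fin k) (Fin k) ℝ)) : ENNReal :=
  Metric.hausdorffEDist (toL1 '' A) (toL1 '' B)

/-- The closed set `L` is the limit of the `k`-shapes of the matrices `S i` in the Hausdorff
distance. Such an `L` is unique. -/
def IsLimitShape {n : ℕ → ℕ} (S : ∀ i, Matrix (Fin (n i)) (Fin (n i)) ℝ) (k : ℕ)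
    (L : Set (Matrix (Fin k) (Fin k) ℝ)) : Prop :=
  IsClosed L ∧ Tendsto (fun i => shapeDist (matrixShape (S i) k) L) atTop (𝓝 0)

/-- Convergence of a sequence of square matrices: for some `c > 0` all entry sums are less than
`c`, and for every `k ≥ 1` the `k`-shapes converge to a closed subset of `[0, c]^(k × k)`. -/
def ShapeConvergent {n : ℕ → ℕ} (S : ∀ i, Matrix (Fin (n i)) (Fin (n i)) ℝ) : Prop :=
  ∃ c : ℝ, 0 < c ∧ (∀ i, entrySum (S i) < c) ∧
    ∀ k : ℕ, 1 ≤ k → ∃ L : Set (Matrix (Fin k) (Fin k) ℝ),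
      (∀ X ∈ L, ∀ a b, X a b ∈ Set.Icc 0 c) ∧ IsLimitShape S k L

end SparseShape

end

/-!
The matrices `S i` are encoded as measures on one compact space, and `μ` comes from a weak limit.

Each limit shape is the closure of a sequence `X k d`, and `X k d` is the limit of `M * S i * Mᵀ`
for balanced fractional partitions `M` of the index sets of the `S i`. Sending an index to its columns
in all these countably many `M` maps the index set of `S i` into a countable product of simplices
(`ColumnSpace`). The image `m i` of the uniform distribution is a probability measure there, and the
image `μ i` of the weights `S i` is a finite measure on the square, of mass less than `c`. Along an
ultrafilter these have weak limits `m` and `μ'`. The coordinate functions of `ColumnSpace` are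
continuous and form balanced partitions for `m`, and their matrices with respect to `μ'` are exactly
the `X k d`; so the limit shape is contained in the closure of the matrices of `μ'`.

Conversely (`pairingMatrix_mem_of_weak_limit`), every measurable balanced partition of `(Y, m)` has
its matrix in the limit shape. It is close in mean, for `m` and for both marginals of `μ'` at once,
to a continuous partition. Pulled back to the index set of `S i`, the continuous partition is nearly
balanced, and mixing it with a constant partition makes it balanced while moving all entries only
slightly (`exists_fractionalPartition_near`).

It remains to replace `(ColumnSpace, m)` by the Cantor set with its uniform measure
(`exists_measure_cantor_pairingMatrix_iff`). The uniform measure maps onto `m` by some `φ`: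
evaluating binary expansions takes it to Lebesgue measure on `[0, 1]`, which maps onto every
probability measure on a standard Borel space. With a disintegration `κ` of the uniform measure over `φ`, the measure `μ` is
the image of `μ'` under the product kernel `κ ∥ₖ κ`; partitions are moved in one direction by
averaging over `κ` and in the other by composing with `φ`. The marginals of `μ'` may be singular to
`m`, so `κ y` has to be carried by the fibre of `φ` over every point `y`. This is arranged in
`exists_fibration_cantorMeasure` by redefining `φ` on a null set that contains a Borel copy of the
whole space.
-/

noncomputable section

namespace SparseShape

instance : IsProbabilityMeasure cantorMeasure := by
  unfold cantorMeasure; infer_instance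

/-! ### The uniform measure of the Cantor set and Lebesgue measure -/

/-- Prepending a bit to a sequence of bits. -/
def consBit (p : Bool × Cantor) : Cantor := fun n => Nat.casesOn n p.1 p.2

lemma measurable_consBit : Measurable consBit := by
  refine measurable_pi_lambda _ fun n => ?_
  cases n with
  | zero => exact measurable_fst
  | succ n => exact (measurable_pi_apply n).comp measurable_snd

/-- The uniform measure of the Cantor set is the law of a fair bit followed by an independent
uniform sequence of bits. -/
lemma map_cons_cantorMeasure :
    ((PMF.uniformOfFintype Bool).toMeasure.prod cantorMeasure).map consBit = cantorMeasure := by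
  refine Measure.eq_infinitePi _ fun s t ht => ?_
  rw [Measure.map_apply measurable_consBit (MeasurableSet.pi s.countable_toSet fun i _ => ht i)]
  have hpre : consBit ⁻¹'
      (Set.pi s t) = (if 0 ∈ s then t 0 else Set.univ) ×ˢ
        Set.pi (s.preimage Nat.succ Nat.succ_injective.injOn : Finset ℕ)
          (fun i => t (i + 1)) := by
    ext ⟨b, c⟩
    simp only [Set.mem_preimage, Set.mem_pi, Set.mem_prod, Finset.mem_coe, Finset.mem_preimage]
    constructor
    · intro h
      refine ⟨?_, fun i hi => h (i + 1) hi⟩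
      split_ifs with h0
      · exact h 0 h0
      · trivial
    · rintro ⟨h0, h1⟩ i hi
      cases i with
      | zero => simpa [hi, consBit] using h0
      | succ i => exact h1 i hi
  rw [hpre, Measure.prod_prod, cantorMeasure, Measure.infinitePi_pi _ (fun i _ => ht (i + 1)),
    ← Finset.prod_filter_mul_prod_filter_not s (· = 0)]
  congr 1
  · rw [Finset.filter_eq']
    split_ifs <;> simp only [Finset.prod_singleton, Finset.prod_empty, measure_univ]
  · classical
    have := Finset.prod_preimage' Nat.succ s Nat.succ_injective.injOn
      (fun i => (PMF.uniformOfFintype Bool).toMeasure (t i))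
    refine this.trans (Finset.prod_congr ?_ fun _ _ => rfl)
    ext i
    cases i <;> simp

/-- The real number in `[0, 1]` with a given binary expansion. -/
def binaryValue (c : Cantor) : ℝ := Real.ofDigits (fun n => (if c n then 1 else 0 : Fin 2))

lemma continuous_binaryValue : Continuous binaryValue := by
  refine Real.continuous_ofDigits.comp (continuous_pi fun n => ?_)
  exact (continuous_of_discreteTopology (f := fun b : Bool => (if b then 1 else 0 : Fin 2))).comp
    (continuous_apply n)

lemma binaryValue_mem (c : Cantor) : binaryValue c ∈ Set.Icc (0 : ℝ) 1 :=
  ⟨Real.ofDigits_nonneg _, Real.ofDigits_le_one _⟩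

lemma binaryValue_cons (b : Bool) (c : Cantor) :
    binaryValue (consBit (b, c)) = ((if b then 1 else 0) + binaryValue c) / 2 := by
  unfold binaryValue consBit
  rw [Real.ofDigits_eq_sum_add_ofDigits _ 1]
  cases b <;> simp [Real.ofDigitsTerm] <;> ring

lemma integral_uniformBool (F : Bool → ℂ) :
    ∫ b, F b ∂(PMF.uniformOfFintype Bool).toMeasure = (F false + F true) / 2 := by
  rw [PMF.integral_eq_sum]
  simp
  ring

/-- The self-similarity of the law of a uniform binary expansion. -/
lemma integral_binaryValue_half (f : ℝ → ℂ) (hf : Continuous f) :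
    ∫ c, f (binaryValue c) ∂cantorMeasure =
      ∫ c, (f (binaryValue c / 2) + f ((1 + binaryValue c) / 2)) / 2 ∂cantorMeasure := by
  obtain ⟨C, hC⟩ := (isCompact_Icc (a := (0 : ℝ)) (b := 1)).exists_bound_of_continuousOn
    hf.continuousOn
  have hfm : Measurable fun c => f (binaryValue c) := (hf.comp continuous_binaryValue).measurable
  conv_lhs => rw [← map_cons_cantorMeasure]
  rw [integral_map measurable_consBit.aemeasurable hfm.aestronglyMeasurable, integral_prod_symm]
  · refine integral_congr_ae (Eventually.of_forall fun c => ?_)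
    simp only [binaryValue_cons]
    rw [integral_uniformBool]
    simp
  · refine Integrable.of_bound (hfm.comp measurable_consBit).aestronglyMeasurable C
      (Eventually.of_forall fun p => hC _ (binaryValue_mem _))

lemma integral_Icc_half (f : ℝ → ℂ) (hf : Continuous f) :
    ∫ x in (0 : ℝ)..1, f x = ∫ x in (0 : ℝ)..1, (f (x / 2) + f ((1 + x) / 2)) / 2 := by
  have h1 : ∫ x in (0 : ℝ)..1, f (x / 2) = 2 * ∫ x in (0 : ℝ)..(1 / 2), f x := by
    rw [intervalIntegral.integral_comp_div _ (two_ne_zero)]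
    simp
  have h2 : ∫ x in (0 : ℝ)..1, f ((1 + x) / 2) = 2 * ∫ x in (1 / 2 : ℝ)..1, f x := by
    have := intervalIntegral.integral_comp_div_add (a := (0 : ℝ)) (b := 1) f
      (two_ne_zero (α := ℝ)) (1 / 2)
    simp only [add_div, add_comm (1 / 2 : ℝ)]
    rw [this]
    norm_num
  have i1 : IntervalIntegrable (fun x : ℝ => f (x / 2)) volume 0 1 :=
    (hf.comp (by fun_prop)).intervalIntegrable _ _
  have i2 : IntervalIntegrable (fun x : ℝ => f ((1 + x) / 2)) volume 0 1 :=
    (hf.comp (by fun_prop)).intervalIntegrable _ _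
  rw [intervalIntegral.integral_div, intervalIntegral.integral_add i1 i2, h1, h2,
    ← intervalIntegral.integral_add_adjacent_intervals
      (hf.intervalIntegrable 0 (1 / 2)) (hf.intervalIntegrable (1 / 2) 1)]
  ring

/-- Averaging over one bit halves the Lipschitz constant of a function and changes neither of the
two integrals, so a Lipschitz function has the same integral for both. -/
lemma norm_integral_binaryValue_sub_le (N : ℕ) : ∀ (f : ℝ → ℂ) (C : ℝ), Continuous f →
    (∀ x y, ‖f x - f y‖ ≤ C * |x - y|) →
      ‖∫ c, f (binaryValue c) ∂cantorMeasure - ∫ x in (0 : ℝ)..1, f x‖ ≤ 2 * C * (1 / 2) ^ N := by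
  induction N with
  | zero =>
    intro f C hf hC
    have h1 : ‖∫ c, (f (binaryValue c) - f 0) ∂cantorMeasure‖ ≤ C := by
      have := norm_integral_le_of_norm_le_const (μ := cantorMeasure) (C := C)
        (f := fun c => f (binaryValue c) - f 0) (Eventually.of_forall fun c => by
          refine (hC _ _).trans ?_
          obtain ⟨h0, h1⟩ := binaryValue_mem c
          have hC0 : 0 ≤ C := by simpa using (norm_nonneg _).trans (hC 1 0)
          rw [sub_zero, abs_of_nonneg h0]
          nlinarith)
      simpa using this
    have h2 : ‖∫ x in (0 : ℝ)..1, (f x - f 0)‖ ≤ C := by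
      have := intervalIntegral.norm_integral_le_of_norm_le_const (a := (0 : ℝ)) (b := 1) (C := C)
        (f := fun x => f x - f 0) (fun x hx => by
          refine (hC _ _).trans ?_
          rw [Set.uIoc_of_le zero_le_one] at hx
          have hC0 : 0 ≤ C := by simpa using (norm_nonneg _).trans (hC 1 0)
          rw [sub_zero, abs_of_pos hx.1]
          nlinarith [hx.2])
      simpa using this
    obtain ⟨B, hB⟩ := (isCompact_Icc (a := (0 : ℝ)) (b := 1)).exists_bound_of_continuousOn
      hf.continuousOn
    have hint : Integrable (fun c => f (binaryValue c)) cantorMeasure :=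
      Integrable.of_bound (hf.comp continuous_binaryValue).measurable.aestronglyMeasurable B
        (Eventually.of_forall fun c => hB _ (binaryValue_mem c))
    rw [integral_sub hint (integrable_const _)] at h1
    rw [intervalIntegral.integral_sub (hf.intervalIntegrable _ _)
      (intervalIntegrable_const)] at h2
    simp only [integral_const, probReal_univ, one_smul, intervalIntegral.integral_const,
      sub_zero] at h1 h2
    calc _ = ‖(∫ c, f (binaryValue c) ∂cantorMeasure - f 0) -
            ((∫ x in (0 : ℝ)..1, f x) - f 0)‖ := by
          congr 1; ring
      _ ≤ C + C := (norm_sub_le _ _).trans (add_le_add h1 h2)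
      _ = _ := by ring
  | succ N ih =>
    intro f C hf hC
    rw [integral_binaryValue_half f hf, integral_Icc_half f hf]
    refine (ih (fun x => (f (x / 2) + f ((1 + x) / 2)) / 2) (C / 2) (by fun_prop) ?_).trans
      (le_of_eq (by ring))
    intro x y
    have e1 := hC (x / 2) (y / 2)
    have e2 := hC ((1 + x) / 2) ((1 + y) / 2)
    rw [show x / 2 - y / 2 = (x - y) / 2 by ring, abs_div, abs_two] at e1
    rw [show (1 + x) / 2 - (1 + y) / 2 = (x - y) / 2 by ring, abs_div, abs_two] at e2
    rw [show (f (x / 2) + f ((1 + x) / 2)) / 2 - (f (y / 2) + f ((1 + y) / 2)) / 2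
      = ((f (x / 2) - f (y / 2)) + (f ((1 + x) / 2) - f ((1 + y) / 2))) / 2 by ring, norm_div]
    have := norm_add_le (f (x / 2) - f (y / 2)) (f ((1 + x) / 2) - f ((1 + y) / 2))
    simp only [Complex.norm_ofNat]
    linarith

/-- Binary expansion turns fair bits into Lebesgue measure. The characteristic functions agree
because the exponentials are Lipschitz. -/
lemma map_binaryValue : cantorMeasure.map binaryValue = volume.restrict (Set.Icc (0 : ℝ) 1) := by
  have hm := continuous_binaryValue.measurable
  have := Measure.isProbabilityMeasure_map (μ := cantorMeasure) hm.aemeasurable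
  refine Measure.ext_of_charFun (funext fun t => ?_)
  have hc : Continuous fun x : ℝ => Complex.exp (t * x * Complex.I) := by fun_prop
  rw [charFun_apply_real, charFun_apply_real, integral_map hm.aemeasurable
    hc.aestronglyMeasurable, integral_Icc_eq_integral_Ioc,
    ← intervalIntegral.integral_of_le zero_le_one, ← sub_eq_zero, ← norm_le_zero_iff]
  have hlim : Tendsto (fun N : ℕ => 2 * |t| * (1 / 2 : ℝ) ^ N) atTop (𝓝 (2 * |t| * 0)) :=
    (tendsto_pow_atTop_nhds_zero_of_lt_one (by norm_num) (by norm_num)).const_mul _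
  rw [mul_zero] at hlim
  refine ge_of_tendsto' hlim fun N => norm_integral_binaryValue_sub_le N _ |t| hc fun x y => ?_
  have := Real.norm_exp_I_mul_ofReal_sub_one_le (x := t * (x - y))
  rw [Real.norm_eq_abs, abs_mul] at this
  refine le_trans (le_of_eq ?_) this
  have e : Complex.exp (t * x * Complex.I) - Complex.exp (t * y * Complex.I)
      = Complex.exp ((t * y : ℝ) * Complex.I) *
        (Complex.exp (Complex.I * (t * (x - y) : ℝ)) - 1) := by
    rw [mul_sub, ← Complex.exp_add, mul_one]
    congr 2
    · push_cast; ring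
    · push_cast; ring
  rw [e, norm_mul, Complex.norm_exp_ofReal_mul_I, one_mul]

/-- Every probability measure on a standard Borel space is an image of the uniform measure of the
Cantor set. -/
lemma exists_map_cantorMeasure_eq {Y : Type*} [MeasurableSpace Y] [StandardBorelSpace Y]
    [Nonempty Y] (m : Measure Y) [IsProbabilityMeasure m] :
    ∃ φ : Cantor → Y, Measurable φ ∧ cantorMeasure.map φ = m := by
  obtain ⟨f, hf, hfm⟩ := m.exists_measurable_map_eq
  let u : Cantor → unitInterval := fun c => ⟨binaryValue c, binaryValue_mem c⟩
  have hu : Measurable u := continuous_binaryValue.measurable.subtype_mk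
  refine ⟨f ∘ u, hf.comp hu, ?_⟩
  rw [← Measure.map_map hf hu, ← hfm]
  congr 1
  have h : (cantorMeasure.map u).map ((↑) : unitInterval → ℝ)
      = (volume : Measure unitInterval).map ((↑) : unitInterval → ℝ) := by
    rw [Measure.map_map measurable_subtype_coe hu, unitInterval.measurePreserving_coe.map_eq]
    exact map_binaryValue
  exact unitInterval.measurableEmbedding_coe.map_injective h

open ProbabilityTheory

/-! ### Fibering the Cantor set over a standard Borel space -/

/-- Every standard Borel space has a copy inside a null set of the Cantor set. -/
lemma exists_measurableEmbedding_null_range (Y : Type*) [MeasurableSpace Y]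
    [StandardBorelSpace Y] :
    ∃ ψ : Y → Cantor, MeasurableEmbedding ψ ∧ cantorMeasure (Set.range ψ) = 0 := by
  obtain ⟨g, hg, hinj⟩ := MeasurableSpace.measurable_injection_nat_bool_of_countablySeparated Y
  -- Spacing the bits out and filling the odd places with `true` gives a null image.
  let ψ : Y → Cantor := fun y n => if Even n then g y (n / 2) else true
  have hψ : Measurable ψ := by
    refine measurable_pi_lambda _ fun n => ?_
    by_cases hn : Even n
    · simp only [ψ, hn, if_true]
      exact (measurable_pi_apply (n / 2)).comp hg
    · simp [ψ, hn]
  have hψinj : Function.Injective ψ := fun y z h => hinj <| funext fun n => by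
    simpa [ψ] using congrFun h (2 * n)
  refine ⟨ψ, hψ.measurableEmbedding hψinj, ?_⟩
  have hle (N : ℕ) : cantorMeasure (Set.range ψ) ≤ (2⁻¹ : ENNReal) ^ N := by
    let s : Finset ℕ := (Finset.range N).image fun i => 2 * i + 1
    have hs : s.card = N := by
      rw [Finset.card_image_of_injective _ fun a b h => by simpa using h, Finset.card_range]
    calc cantorMeasure (Set.range ψ) ≤ cantorMeasure (Set.pi s fun _ => {true}) := by
          refine measure_mono ?_
          rintro _ ⟨y, rfl⟩ n hn
          obtain ⟨i, -, rfl⟩ := Finset.mem_image.1 hn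
          simp [ψ]
      _ = (2⁻¹ : ENNReal) ^ N := by
          rw [cantorMeasure, Measure.infinitePi_pi _ fun _ _ => measurableSet_singleton _,
            Finset.prod_const, hs, PMF.toMeasure_apply_singleton _ _ (measurableSet_singleton _)]
          simp
  have hlim : Tendsto (fun N : ℕ => (2⁻¹ : ENNReal) ^ N) atTop (𝓝 0) :=
    ENNReal.tendsto_pow_atTop_nhds_zero_of_lt_one (by simp)
  exact le_antisymm (ge_of_tendsto' hlim hle) zero_le

/-- A probability measure `m` on a standard Borel space `Y` is the image of the uniform measure of
the Cantor set under a map whose disintegration `κ` is carried by the fibre over *every* point of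
`Y`, not only over almost every one. This matters since a measure on `Y × Y` may have marginals
which are singular to `m`. -/
theorem exists_fibration_cantorMeasure {Y : Type*} [MeasurableSpace Y] [StandardBorelSpace Y]
    (m : Measure Y) [IsProbabilityMeasure m] :
    ∃ (φ : Cantor → Y) (κ : Kernel Y Cantor), Measurable φ ∧ IsMarkovKernel κ ∧
      m.bind κ = cantorMeasure ∧ ∀ y, ∀ᵐ c ∂κ y, φ c = y := by
  have : Nonempty Y := nonempty_of_isProbabilityMeasure m
  obtain ⟨φ₀, hφ₀, hmap₀⟩ := exists_map_cantorMeasure_eq m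
  obtain ⟨ψ, hψ, hnull⟩ := exists_measurableEmbedding_null_range Y
  classical
  let φ : Cantor → Y := fun c => if c ∈ Set.range ψ then hψ.invFun c else φ₀ c
  have hφ : Measurable φ := Measurable.ite hψ.measurableSet_range hψ.measurable_invFun hφ₀
  have hφψ (y : Y) : φ (ψ y) = y := by
    simp only [φ, Set.mem_range_self, if_true]
    exact hψ.leftInverse_invFun y
  have hmap : cantorMeasure.map φ = m := by
    rw [← hmap₀]
    refine Measure.map_congr ?_
    filter_upwards [measure_eq_zero_iff_ae_notMem.1 hnull] with c hc
    simp only [φ, if_neg hc]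
  let κ₀ : Kernel Y Cantor := condDistrib id φ cantorMeasure
  have hgraph : MeasurableSet {p : Y × Cantor | φ p.2 = p.1} :=
    measurableSet_eq_fun (hφ.comp measurable_snd) measurable_fst
  have hae : ∀ᵐ y ∂m, ∀ᵐ c ∂κ₀ y, φ c = y := by
    have hcp : m ⊗ₘ κ₀ = cantorMeasure.map fun c => (φ c, id c) := by
      rw [← hmap]; exact compProd_map_condDistrib aemeasurable_id
    refine Measure.ae_ae_of_ae_compProd (p := fun p : Y × Cantor => φ p.2 = p.1) ?_
    rw [hcp, ae_map_iff (hφ.prodMk measurable_id).aemeasurable hgraph]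
    simp
  -- The points whose fibre carries `κ₀`; on the `m`-null rest, `κ` is the point mass at `ψ y`.
  let A : Set Y := {y | κ₀ y (Prod.mk y ⁻¹' {p : Y × Cantor | φ p.2 = p.1}ᶜ) = 0}
  have hA : MeasurableSet A :=
    Kernel.measurable_kernel_prodMk_left hgraph.compl (measurableSet_singleton 0)
  let κ : Kernel Y Cantor := Kernel.piecewise hA κ₀ (Kernel.deterministic ψ hψ.measurable)
  refine ⟨φ, κ, hφ, inferInstance, ?_, fun y => ?_⟩
  · have hκ : κ =ᵐ[m] κ₀ := by
      filter_upwards [hae] with y hy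
      rw [Kernel.piecewise_apply, if_pos (show y ∈ A from hy)]
    rw [Measure.bind_congr_right hκ, ← hmap]
    have := condDistrib_comp_map (μ := cantorMeasure) (Y := id) hφ.aemeasurable aemeasurable_id
    rwa [Measure.map_id] at this
  · rw [Kernel.piecewise_apply]
    split_ifs with hy
    · exact hy
    · rw [Kernel.deterministic_apply]
      exact (ae_dirac_iff (hφ (measurableSet_singleton y))).2 (hφψ y)

/-! ### Balanced fractional partitions of a probability space -/

/-- Balanced fractional partitions of a probability space `(Y, m)` into `k` parts. For the Cantor
set with its uniform measure these are the tuples with `IsFractionalPartition`. -/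
def IsBalancedPartition {Y : Type*} [MeasurableSpace Y] (m : Measure Y) {k : ℕ}
    (g : Fin k → Y → ℝ) : Prop :=
  (∀ i, Measurable (g i)) ∧ (∀ i y, 0 ≤ g i y) ∧ (∀ y, ∑ i, g i y = 1) ∧
    ∀ i, ∫ y, g i y ∂m = 1 / (k : ℝ)

/-- The matrix of a measure on `Y × Y` with respect to a tuple of functions on `Y`; for the Cantor
set this is `factorMatrix`. -/
def pairingMatrix {Y : Type*} [MeasurableSpace Y] (μ : Measure (Y × Y)) {k : ℕ}
    (g : Fin k → Y → ℝ) : Matrix (Fin k) (Fin k) ℝ :=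
  Matrix.of fun i j => ∫ p, g i p.1 * g j p.2 ∂μ

lemma le_one_of_sum_eq_one {k : ℕ} {v : Fin k → ℝ} (h0 : ∀ i, 0 ≤ v i) (h1 : ∑ i, v i = 1)
    (i : Fin k) : v i ≤ 1 :=
  h1 ▸ Finset.single_le_sum (fun j _ => h0 j) (Finset.mem_univ i)

lemma integral_bind_kernel {Y Z : Type*} [MeasurableSpace Y] [MeasurableSpace Z]
    (μ : Measure Y) [IsFiniteMeasure μ] (κ : Kernel Y Z) [IsMarkovKernel κ] {f : Z → ℝ}
    (hf : Measurable f) {C : ℝ} (hC : ∀ z, |f z| ≤ C) :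
    ∫ z, f z ∂(μ.bind κ) = ∫ y, ∫ z, f z ∂κ y ∂μ := by
  have hint : Integrable f (μ.bind κ) :=
    Integrable.of_bound hf.aestronglyMeasurable C (Eventually.of_forall hC)
  rw [Measure.comp_eq_comp_const_apply] at hint ⊢
  rw [Kernel.integral_comp hint, Kernel.const_apply]

lemma integral_bind_parallelComp {Y Z : Type*} [MeasurableSpace Y] [MeasurableSpace Z]
    (μ : Measure (Y × Y)) [IsFiniteMeasure μ] (κ : Kernel Y Z) [IsMarkovKernel κ] {f g : Z → ℝ}
    (hf : Measurable f) (hg : Measurable g) (hf1 : ∀ z, |f z| ≤ 1) (hg1 : ∀ z, |g z| ≤ 1) :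
    ∫ p, f p.1 * g p.2 ∂(μ.bind (κ ∥ₖ κ)) =
      ∫ p, (∫ z, f z ∂κ p.1) * (∫ z, g z ∂κ p.2) ∂μ := by
  have hm : Measurable fun p : Z × Z => f p.1 * g p.2 := by fun_prop
  rw [integral_bind_kernel μ (κ ∥ₖ κ) (C := 1) hm]
  · refine integral_congr_ae (Eventually.of_forall fun p => ?_)
    simp only [Kernel.parallelComp_apply]
    exact integral_prod_mul f g
  · intro p
    rw [abs_mul]
    exact mul_le_one₀ (hf1 _) (abs_nonneg _) (hg1 _)

/-- Averaging over the fibres of `φ` and composing with `φ` match the balanced partitions of the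
Cantor set with those of `Y`, so every finite measure on `Y × Y` has the same matrices as a measure
on the square of the Cantor set. -/
theorem exists_measure_cantor_pairingMatrix_iff {Y : Type*} [MeasurableSpace Y]
    [StandardBorelSpace Y] (m : Measure Y) [IsProbabilityMeasure m] (μ' : Measure (Y × Y))
    [IsFiniteMeasure μ'] (hsymm : μ'.map Prod.swap = μ') :
    ∃ μ : Measure (Cantor × Cantor), IsFiniteMeasure μ ∧ μ.map Prod.swap = μ ∧
      ∀ (k : ℕ) (X : Matrix (Fin k) (Fin k) ℝ),
        (∃ f : Fin k → Cantor → ℝ, IsFractionalPartition f ∧ X = factorMatrix μ f) ↔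
          ∃ g : Fin k → Y → ℝ, IsBalancedPartition m g ∧ X = pairingMatrix μ' g := by
  obtain ⟨φ, κ, hφ, hκ, hbind, hfib⟩ := exists_fibration_cantorMeasure m
  refine ⟨μ'.bind (κ ∥ₖ κ), inferInstance, ?_, fun k X => ⟨?_, ?_⟩⟩
  · rw [← Measure.swap_comp, Measure.comp_assoc, Kernel.swap_parallelComp, ← Measure.comp_assoc,
      Measure.swap_comp, hsymm]
  · rintro ⟨f, ⟨hfm, hf0, hf1, hfint⟩, rfl⟩
    have hle (i c) : |f i c| ≤ 1 := by
      rw [abs_of_nonneg (hf0 i c)]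
      exact le_one_of_sum_eq_one (fun i => hf0 i c) (hf1 c) i
    refine ⟨fun i y => ∫ c, f i c ∂κ y,
      ⟨fun i => ?_, fun i y => integral_nonneg (hf0 i), fun y => ?_, fun i => ?_⟩, ?_⟩
    · exact (hfm i).stronglyMeasurable.integral_kernel.measurable
    · rw [← integral_finsetSum _ fun i _ => Integrable.of_bound
        (hfm i).aestronglyMeasurable 1 (Eventually.of_forall (hle i))]
      simp [hf1]
    · rw [← integral_bind_kernel m κ (hfm i) (hle i), hbind, hfint]
    · ext i j
      exact integral_bind_parallelComp μ' κ (hfm i) (hfm j) (hle i) (hle j)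
  · rintro ⟨g, ⟨hgm, hg0, hg1, hgint⟩, rfl⟩
    have hle (i y) : |g i y| ≤ 1 := by
      rw [abs_of_nonneg (hg0 i y)]
      exact le_one_of_sum_eq_one (fun i => hg0 i y) (hg1 y) i
    have havg (i : Fin k) (y : Y) : ∫ c, g i (φ c) ∂κ y = g i y := by
      rw [integral_congr_ae ((hfib y).mono fun c hc => congrArg (g i) hc)]
      simp
    refine ⟨fun i c => g i (φ c),
      ⟨fun i => (hgm i).comp hφ, fun i c => hg0 i _, fun c => hg1 _, fun i => ?_⟩, ?_⟩
    · rw [← hbind]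
      refine (integral_bind_kernel m κ ((hgm i).comp hφ) (fun c => hle i (φ c))).trans ?_
      simp only [Function.comp_apply, havg, hgint]
    · ext i j
      refine Eq.trans ?_ (integral_bind_parallelComp μ' κ ((hgm i).comp hφ) ((hgm j).comp hφ)
        (fun c => hle i _) (fun c => hle j _)).symm
      simp only [Function.comp_apply, havg]
      rfl

/-! ### Approximation by continuous partitions and weak limits -/

/-- A continuous retraction of `ℝᵏ` onto the standard simplex: negative coordinates are cut off, a
total mass above `1` is scaled down, and a missing mass is spread evenly. -/
def simplexRetraction {k : ℕ} (v : Fin k → ℝ) (i : Fin k) : ℝ :=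
  max (v i) 0 / max (∑ j, max (v j) 0) 1 +
    (1 - (∑ j, max (v j) 0) / max (∑ j, max (v j) 0) 1) / k

lemma continuous_simplexRetraction {k : ℕ} (i : Fin k) :
    Continuous fun v : Fin k → ℝ => simplexRetraction v i := by
  unfold simplexRetraction
  have h (v : Fin k → ℝ) : max (∑ j, max (v j) 0) 1 ≠ 0 :=
    (lt_of_lt_of_le one_pos (le_max_right _ _)).ne'
  fun_prop (disch := exact h)

lemma simplexRetraction_nonneg {k : ℕ} (v : Fin k → ℝ) (i : Fin k) :
    0 ≤ simplexRetraction v i := by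
  have h1 : (∑ j, max (v j) 0) / max (∑ j, max (v j) 0) 1 ≤ 1 :=
    div_le_one_of_le₀ (le_max_left _ _) (zero_le_one.trans (le_max_right _ _))
  exact add_nonneg (div_nonneg (le_max_right _ _) (zero_le_one.trans (le_max_right _ _)))
    (div_nonneg (sub_nonneg.2 h1) k.cast_nonneg)

lemma sum_simplexRetraction {k : ℕ} (hk : k ≠ 0) (v : Fin k → ℝ) :
    ∑ i, simplexRetraction v i = 1 := by
  have hk' : (k : ℝ) ≠ 0 := Nat.cast_ne_zero.2 hk
  simp only [simplexRetraction, Finset.sum_add_distrib, ← Finset.sum_div, Finset.sum_const,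
    Finset.card_univ, Fintype.card_fin, nsmul_eq_mul]
  field_simp
  ring

lemma abs_simplexRetraction_sub_le {k : ℕ} (v w : Fin k → ℝ) (hw0 : ∀ i, 0 ≤ w i)
    (hw1 : ∑ i, w i = 1) (i : Fin k) :
    |simplexRetraction v i - w i| ≤ 2 * ∑ j, |v j - w j| := by
  have hcut (j) : |max (v j) 0 - w j| ≤ |v j - w j| := by
    have := abs_max_sub_max_le_abs (v j) (w j) 0
    rwa [max_eq_left (hw0 j)] at this
  have hsum : |(∑ j, max (v j) 0) - 1| ≤ ∑ j, |v j - w j| := by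
    rw [← hw1, ← Finset.sum_sub_distrib]
    exact (Finset.abs_sum_le_sum_abs _ _).trans (Finset.sum_le_sum fun j _ => hcut j)
  have hi : |v i - w i| ≤ ∑ j, |v j - w j| :=
    Finset.single_le_sum (f := fun j => |v j - w j|) (fun j _ => abs_nonneg _)
      (Finset.mem_univ i)
  have hu : max (v i) 0 ≤ ∑ j, max (v j) 0 :=
    Finset.single_le_sum (f := fun j => max (v j) 0) (fun j _ => le_max_right _ _)
      (Finset.mem_univ i)
  have hu0 : 0 ≤ max (v i) 0 := le_max_right _ _
  have hk : (1 : ℝ) ≤ k := by exact_mod_cast i.pos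
  have hmove : |simplexRetraction v i - max (v i) 0| ≤ |(∑ j, max (v j) 0) - 1| := by
    unfold simplexRetraction
    set s := ∑ j, max (v j) 0
    set u := max (v i) 0
    rcases le_total s 1 with hs | hs
    · rw [max_eq_right hs, div_one, div_one, add_sub_cancel_left, abs_sub_comm s 1,
        abs_of_nonneg (div_nonneg (sub_nonneg.2 hs) (by linarith)),
        abs_of_nonneg (sub_nonneg.2 hs)]
      exact div_le_self (sub_nonneg.2 hs) hk
    · have hs0 : 0 < s := by linarith
      rw [max_eq_left hs, div_self hs0.ne', sub_self, zero_div, add_zero, abs_sub_comm,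
        abs_of_nonneg (sub_nonneg.2 (div_le_self hu0 hs)), abs_of_nonneg (sub_nonneg.2 hs)]
      have : u - u / s = (u / s) * (s - 1) := by field_simp
      rw [this]
      exact mul_le_of_le_one_left (by linarith) (div_le_one_of_le₀ hu hs0.le)
  calc |simplexRetraction v i - w i|
      ≤ |simplexRetraction v i - max (v i) 0| + |max (v i) 0 - w i| := abs_sub_le _ _ _
    _ ≤ 2 * ∑ j, |v j - w j| := by linarith [hcut i]

/-- A measurable fractional partition is close in mean to a continuous one. -/
lemma exists_continuous_partition_integral_sub_le {Y : Type*} [TopologicalSpace Y] [NormalSpace Y]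
    [MeasurableSpace Y] [BorelSpace Y] (ρ : Measure Y) [IsFiniteMeasure ρ] [ρ.WeaklyRegular]
    {k : ℕ} (hk : k ≠ 0) (g : Fin k → Y → ℝ) (hgm : ∀ i, Measurable (g i))
    (hg0 : ∀ i y, 0 ≤ g i y) (hg1 : ∀ y, ∑ i, g i y = 1) {ε : ℝ} (hε : 0 < ε) :
    ∃ h : Fin k → Y → ℝ, (∀ i, Continuous (h i)) ∧ (∀ i y, 0 ≤ h i y) ∧
      (∀ y, ∑ i, h i y = 1) ∧ ∀ i, ∫ y, |g i y - h i y| ∂ρ ≤ ε := by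
  have hgint (i) : Integrable (g i) ρ := by
    refine Integrable.of_bound (hgm i).aestronglyMeasurable 1 (Eventually.of_forall fun y => ?_)
    rw [Real.norm_eq_abs, abs_of_nonneg (hg0 i y)]
    exact le_one_of_sum_eq_one (fun i => hg0 i y) (hg1 y) i
  have hk' : (0 : ℝ) < k := by positivity
  have hε' : 0 < ε / (2 * k) := by positivity
  choose f hf hfint using fun i => (hgint i).exists_boundedContinuous_integral_sub_le hε'
  refine ⟨fun i y => simplexRetraction (fun j => f j y) i, fun i => ?_,
    fun i y => simplexRetraction_nonneg _ i, fun y => sum_simplexRetraction hk _, fun i => ?_⟩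
  · exact (continuous_simplexRetraction i).comp (continuous_pi fun j => (f j).continuous)
  · have hint (j) : Integrable (fun y => |g j y - f j y|) ρ := ((hgint j).sub (hfint j)).abs
    calc ∫ y, |g i y - simplexRetraction (fun j => f j y) i| ∂ρ
        ≤ ∫ y, 2 * ∑ j, |g j y - f j y| ∂ρ := by
          refine integral_mono_of_nonneg (Eventually.of_forall fun y => abs_nonneg _)
            ((integrable_finsetSum _ fun j _ => hint j).const_mul 2)
            (Eventually.of_forall fun y => ?_)
          have := abs_simplexRetraction_sub_le (fun j => f j y) (fun j => g j y)
            (fun j => hg0 j y) (hg1 y) i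
          simpa only [abs_sub_comm] using this
      _ = 2 * ∑ j, ∫ y, |g j y - f j y| ∂ρ := by
          rw [integral_const_mul, integral_finsetSum _ fun j _ => hint j]
      _ ≤ 2 * ∑ _j : Fin k, ε / (2 * k) := by
          gcongr with j
          exact hf j
      _ = ε := by
          simp only [Finset.sum_const, Finset.card_univ, Fintype.card_fin, nsmul_eq_mul]
          field_simp

/-- Weak compactness of the finite measures of bounded mass on a compact space. -/
lemma exists_weak_limit {Y : Type*} [TopologicalSpace Y] [CompactSpace Y]
    [TopologicalSpace.MetrizableSpace Y] [MeasurableSpace Y] [BorelSpace Y]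
    (μ : ℕ → Measure Y) [∀ i, IsFiniteMeasure (μ i)] {C : ℝ}
    (hC : ∀ i, (μ i).real Set.univ ≤ C) (U : Ultrafilter ℕ) :
    ∃ μ' : Measure Y, IsFiniteMeasure μ' ∧
      ∀ f : Y → ℝ, Continuous f → Tendsto (fun i => ∫ y, f y ∂μ i) U (𝓝 (∫ y, f y ∂μ')) := by
  have hC0 : 0 ≤ C := measureReal_nonneg.trans (hC 0)
  let F : ℕ → FiniteMeasure Y := fun i => ⟨μ i, inferInstance⟩
  have hmem : ∀ i, F i ∈ {ν : FiniteMeasure Y | ν.mass ≤ C.toNNReal} := fun i => by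
    refine NNReal.coe_le_coe.1 ?_
    rw [Real.coe_toNNReal _ hC0]
    exact hC i
  obtain ⟨μ', -, hμ'⟩ := (isCompact_setOfPred_finiteMeasure_le_of_compactSpace Y
    C.toNNReal).ultrafilter_le_nhds (U.map F) (le_principal_iff.2 (by
      rw [Ultrafilter.mem_coe, Ultrafilter.mem_map]
      exact Filter.univ_mem' hmem))
  refine ⟨μ', inferInstance, fun f hf => ?_⟩
  exact FiniteMeasure.tendsto_iff_forall_integral_tendsto.1 (show Tendsto F U (𝓝 μ') from hμ')
    (BoundedContinuousFunction.mkOfCompact ⟨f, hf⟩)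

/-! ### Matrices as measures -/

section Empirical

variable {Y : Type*} [MeasurableSpace Y] {n : ℕ}

/-- The uniform distribution on the points `Φ x`; if there are no points, the point mass at `p`,
so that it is a probability measure in every case. -/
def empiricalMeasure (p : Y) (Φ : Fin n → Y) : Measure Y :=
  if n = 0 then Measure.dirac p else (n : ENNReal)⁻¹ • ∑ x, Measure.dirac (Φ x)

/-- The measure with mass `S x y` at the point `(Φ x, Φ y)`. -/
def weightMeasure (S : Matrix (Fin n) (Fin n) ℝ) (Φ : Fin n → Y) : Measure (Y × Y) :=
  ∑ x, ∑ y, ENNReal.ofReal (S x y) • Measure.dirac (Φ x, Φ y)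

instance (p : Y) (Φ : Fin n → Y) : IsProbabilityMeasure (empiricalMeasure p Φ) := by
  unfold empiricalMeasure
  split_ifs with h
  · infer_instance
  · refine ⟨?_⟩
    simp [Measure.smul_apply, Measure.finsetSum_apply]
    exact ENNReal.inv_mul_cancel (by exact_mod_cast h) (ENNReal.natCast_ne_top n)

instance (S : Matrix (Fin n) (Fin n) ℝ) (Φ : Fin n → Y) : IsFiniteMeasure (weightMeasure S Φ) := by
  refine ⟨?_⟩
  simp [weightMeasure, Measure.finsetSum_apply, ENNReal.sum_lt_top]

lemma integral_empiricalMeasure (p : Y) (Φ : Fin n → Y) (hn : n ≠ 0) {f : Y → ℝ}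
    (hf : Measurable f) : ∫ y, f y ∂empiricalMeasure p Φ = (∑ x, f (Φ x)) / n := by
  rw [empiricalMeasure, if_neg hn, integral_smul_measure, integral_finsetSum_measure]
  · simp_rw [integral_dirac' f _ hf.stronglyMeasurable]
    simp [div_eq_inv_mul]
  · exact fun x _ => integrable_dirac' hf.stronglyMeasurable enorm_lt_top

lemma integral_weightMeasure (S : Matrix (Fin n) (Fin n) ℝ) (hS : ∀ x y, 0 ≤ S x y)
    (Φ : Fin n → Y) {f : Y × Y → ℝ} (hf : Measurable f) :
    ∫ q, f q ∂weightMeasure S Φ = ∑ x, ∑ y, S x y * f (Φ x, Φ y) := by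
  have hint (x y) : Integrable f (ENNReal.ofReal (S x y) • Measure.dirac (Φ x, Φ y)) :=
    (integrable_dirac' hf.stronglyMeasurable enorm_lt_top).smul_measure ENNReal.ofReal_ne_top
  rw [weightMeasure, integral_finsetSum_measure fun x _ =>
    integrable_finsetSum_measure.2 fun y _ => hint x y]
  refine Finset.sum_congr rfl fun x _ => ?_
  rw [integral_finsetSum_measure fun y _ => hint x y]
  refine Finset.sum_congr rfl fun y _ => ?_
  rw [integral_smul_measure, integral_dirac' f _ hf.stronglyMeasurable,
    ENNReal.toReal_ofReal (hS x y), smul_eq_mul]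

lemma weightMeasure_real_univ (S : Matrix (Fin n) (Fin n) ℝ) (hS : ∀ x y, 0 ≤ S x y)
    (Φ : Fin n → Y) : (weightMeasure S Φ).real Set.univ = entrySum S := by
  have := integral_weightMeasure S hS Φ (f := fun _ => 1) measurable_const
  simpa [entrySum] using this

lemma map_swap_weightMeasure (S : Matrix (Fin n) (Fin n) ℝ) (hS : S.IsSymm) (Φ : Fin n → Y) :
    (weightMeasure S Φ).map Prod.swap = weightMeasure S Φ := by
  have h : (weightMeasure S Φ).map Prod.swap =
      ∑ x, ∑ y, ENNReal.ofReal (S x y) • Measure.dirac (Φ y, Φ x) := by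
    simp_rw [weightMeasure, ← Measure.mapₗ_apply_of_measurable measurable_swap, map_sum,
      map_smul, Measure.mapₗ_apply_of_measurable measurable_swap,
      Measure.map_dirac' measurable_swap, Prod.swap_prod_mk]
  rw [h, Finset.sum_comm, weightMeasure]
  refine Finset.sum_congr rfl fun x _ => Finset.sum_congr rfl fun y _ => ?_
  rw [hS.apply]

end Empirical

/-! ### Rounding an approximate fractional partition of a matrix -/

lemma mul_mul_transpose_apply {k n : ℕ} (S : Matrix (Fin n) (Fin n) ℝ)
    (M : Matrix (Fin k) (Fin n) ℝ) (a b : Fin k) :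
    (M * S * M.transpose) a b = ∑ x, ∑ y, S x y * (M a x * M b y) := by
  simp only [Matrix.mul_apply, Matrix.transpose_apply, Finset.sum_mul]
  rw [Finset.sum_comm]
  refine Finset.sum_congr rfl fun x _ => Finset.sum_congr rfl fun y _ => ?_
  ring

lemma fractionalPartitions_le_one {k n : ℕ} {M : Matrix (Fin k) (Fin n) ℝ}
    (hM : M ∈ fractionalPartitions k n) (a : Fin k) (x : Fin n) : M a x ≤ 1 :=
  le_one_of_sum_eq_one (fun a => hM.1 a x) (hM.2.2 x) a

/-- A nearly balanced fractional partition is uniformly close to a balanced one: a convex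
combination with a suitable constant partition has the right row sums. -/
lemma exists_fractionalPartition_near {k n : ℕ} (hk : k ≠ 0) {t : ℝ} (ht0 : 0 < t) (ht1 : t ≤ 1)
    (G : Fin k → Fin n → ℝ) (hG0 : ∀ a x, 0 ≤ G a x) (hG1 : ∀ x, ∑ a, G a x = 1)
    (hrow : ∀ a, n ≠ 0 → |(∑ x, G a x) / n - 1 / k| ≤ t / k) :
    ∃ M ∈ fractionalPartitions k n, ∀ a x, |M a x - G a x| ≤ t := by
  rcases eq_or_ne n 0 with rfl | hn
  · exact ⟨G, ⟨hG0, by simp, hG1⟩, fun a x => x.elim0⟩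
  have hk' : (0 : ℝ) < k := by positivity
  have hn' : (0 : ℝ) < n := by positivity
  -- The constant partition which the row sums of the convex combination force; the bound on the
  -- row sums of `G` is what makes it nonnegative.
  let c : Fin k → ℝ := fun a => (1 / k - (1 - t) * ((∑ x, G a x) / n)) / t
  have hc0 (a) : 0 ≤ c a := by
    refine div_nonneg ?_ ht0.le
    have h1 : (∑ x, G a x) / n ≤ 1 / k + t / k := by linarith [(abs_le.1 (hrow a hn)).2]
    have h2 : (1 - t) * ((∑ x, G a x) / n) ≤ (1 - t) * (1 / k + t / k) :=
      mul_le_mul_of_nonneg_left h1 (by linarith)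
    have h3 : (1 - t) * (1 / k + t / k) = 1 / k - t ^ 2 / k := by ring
    have h4 : 0 ≤ t ^ 2 / k := by positivity
    linarith
  have hc1 : ∑ a, c a = 1 := by
    have hsum : ∑ a, ∑ x, G a x = n := by rw [Finset.sum_comm]; simp [hG1]
    simp only [c, ← Finset.sum_div, Finset.sum_sub_distrib, ← Finset.mul_sum, hsum,
      Finset.sum_const, Finset.card_univ, Fintype.card_fin, nsmul_eq_mul, mul_one]
    field_simp
    ring
  refine ⟨fun a x => (1 - t) * G a x + t * c a, ⟨fun a x => ?_, fun a => ?_, fun x => ?_⟩,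
    fun a x => ?_⟩
  · exact add_nonneg (mul_nonneg (by linarith) (hG0 a x)) (mul_nonneg ht0.le (hc0 a))
  · simp only [Finset.sum_add_distrib, ← Finset.mul_sum, Finset.sum_const, Finset.card_univ,
      Fintype.card_fin, nsmul_eq_mul, c]
    field_simp
    ring
  · rw [Finset.sum_add_distrib, ← Finset.mul_sum, ← Finset.mul_sum, hG1, hc1]
    ring
  · have h1 := le_one_of_sum_eq_one (fun a => hG0 a x) (hG1 x) a
    have h2 := le_one_of_sum_eq_one hc0 hc1 a
    have e : (1 - t) * G a x + t * c a - G a x = t * (c a - G a x) := by ring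
    rw [e, abs_mul, abs_of_pos ht0]
    refine mul_le_of_le_one_right ht0.le (abs_le.2 ⟨?_, ?_⟩) <;> linarith [hc0 a, hG0 a x]

lemma abs_mul_sub_mul_le {a b a' b' : ℝ} (hb0 : 0 ≤ b) (hb1 : b ≤ 1) (ha0 : 0 ≤ a')
    (ha1 : a' ≤ 1) : |a * b - a' * b'| ≤ |a - a'| + |b - b'| := by
  have e : a * b - a' * b' = (a - a') * b + a' * (b - b') := by ring
  rw [e]
  refine (abs_add_le _ _).trans (add_le_add ?_ ?_)
  · rw [abs_mul, abs_of_nonneg hb0]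
    exact mul_le_of_le_one_right (abs_nonneg _) hb1
  · rw [abs_mul, abs_of_nonneg ha0]
    exact mul_le_of_le_one_left (abs_nonneg _) ha1

lemma abs_sum_weights_sub_le {k n : ℕ} (S : Matrix (Fin n) (Fin n) ℝ) (hS : ∀ x y, 0 ≤ S x y)
    {t : ℝ} (M G : Matrix (Fin k) (Fin n) ℝ) (hM0 : ∀ a x, 0 ≤ M a x) (hM1 : ∀ a x, M a x ≤ 1)
    (hG0 : ∀ a x, 0 ≤ G a x) (hG1 : ∀ a x, G a x ≤ 1) (hMG : ∀ a x, |M a x - G a x| ≤ t)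
    (a b : Fin k) :
    |∑ x, ∑ y, S x y * (M a x * M b y) - ∑ x, ∑ y, S x y * (G a x * G b y)|
      ≤ 2 * t * entrySum S := by
  simp only [← Finset.sum_sub_distrib, ← mul_sub, entrySum, Finset.mul_sum]
  refine (Finset.abs_sum_le_sum_abs _ _).trans (Finset.sum_le_sum fun x _ => ?_)
  refine (Finset.abs_sum_le_sum_abs _ _).trans (Finset.sum_le_sum fun y _ => ?_)
  rw [abs_mul, abs_of_nonneg (hS x y), mul_comm]
  refine mul_le_mul_of_nonneg_right ?_ (hS x y)
  refine (abs_mul_sub_mul_le (hM0 _ _) (hM1 _ _) (hG0 _ _) (hG1 _ _)).trans ?_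
  linarith [hMG a x, hMG b y]

/-! ### Hausdorff convergence of shapes, entry by entry -/

lemma abs_entry_sub_le_dist {k : ℕ} (X Y : Matrix (Fin k) (Fin k) ℝ) (a b : Fin k) :
    |X a b - Y a b| ≤ dist (toL1 X) (toL1 Y) := by
  rw [dist_eq_norm]
  exact PiLp.norm_apply_le (toL1 X - toL1 Y) (a, b)

lemma eventually_exists_mem_limitShape {n : ℕ → ℕ} {S : ∀ i, Matrix (Fin (n i)) (Fin (n i)) ℝ}
    {k : ℕ} {L : Set (Matrix (Fin k) (Fin k) ℝ)} (hL : IsLimitShape S k L) {η : ℝ} (hη : 0 < η) :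
    ∀ᶠ i in atTop, ∀ X ∈ matrixShape (S i) k, ∃ X' ∈ L, ∀ a b, |X a b - X' a b| ≤ η := by
  filter_upwards [hL.2.eventually_lt_const (ENNReal.ofReal_pos.2 hη)] with i hi X hX
  obtain ⟨_, ⟨X', hX', rfl⟩, hd⟩ :=
    Metric.exists_edist_lt_of_hausdorffEDist_lt (Set.mem_image_of_mem toL1 hX) hi
  refine ⟨X', hX', fun a b => (abs_entry_sub_le_dist X X' a b).trans ?_⟩
  rw [edist_dist] at hd
  exact (ENNReal.ofReal_lt_ofReal_iff hη).1 hd |>.le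

lemma matrixShape_nonempty {n : ℕ} (S : Matrix (Fin n) (Fin n) ℝ) {k : ℕ} (hk : k ≠ 0) :
    (matrixShape S k).Nonempty := by
  refine ⟨_, fun _ _ => 1 / (k : ℝ), ⟨fun _ _ => by positivity, fun _ => ?_, fun _ => ?_⟩, rfl⟩
  · simp [div_eq_mul_inv]
  · have : (k : ℝ) ≠ 0 := Nat.cast_ne_zero.2 hk
    simp [this]

lemma exists_tendsto_of_mem_limitShape {n : ℕ → ℕ} {S : ∀ i, Matrix (Fin (n i)) (Fin (n i)) ℝ}
    {k : ℕ} (hk : k ≠ 0) {L : Set (Matrix (Fin k) (Fin k) ℝ)} (hL : IsLimitShape S k L)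
    {X : Matrix (Fin k) (Fin k) ℝ} (hX : X ∈ L) :
    ∃ M : ∀ i, Matrix (Fin k) (Fin (n i)) ℝ, (∀ i, M i ∈ fractionalPartitions k (n i)) ∧
      ∀ a b, Tendsto (fun i => (M i * S i * (M i).transpose) a b) atTop (𝓝 (X a b)) := by
  have hex (i : ℕ) : ∃ M ∈ fractionalPartitions k (n i),
      edist (toL1 X) (toL1 (M * S i * M.transpose)) ≤
        shapeDist (matrixShape (S i) k) L + ((i : ENNReal) + 1)⁻¹ := by
    have hle : Metric.infEDist (toL1 X) (toL1 '' matrixShape (S i) k) ≤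
        shapeDist (matrixShape (S i) k) L := by
      rw [shapeDist, Metric.hausdorffEDist_comm]
      exact Metric.infEDist_le_hausdorffEDist_of_mem (Set.mem_image_of_mem _ hX)
    have hfin : Metric.infEDist (toL1 X) (toL1 '' matrixShape (S i) k) ≠ ⊤ :=
      Metric.infEDist_ne_top ((matrixShape_nonempty (S i) hk).image _)
    have hlt : Metric.infEDist (toL1 X) (toL1 '' matrixShape (S i) k) <
        Metric.infEDist (toL1 X) (toL1 '' matrixShape (S i) k) + ((i : ENNReal) + 1)⁻¹ := by
      refine ENNReal.lt_add_right hfin (ENNReal.inv_ne_zero.2 ?_)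
      exact ENNReal.add_ne_top.2 ⟨ENNReal.natCast_ne_top i, ENNReal.one_ne_top⟩
    obtain ⟨_, ⟨_, ⟨M, hM, rfl⟩, rfl⟩, hd⟩ := Metric.infEDist_lt_iff.1 hlt
    exact ⟨M, hM, hd.le.trans (by gcongr)⟩
  choose M hM hd using hex
  refine ⟨M, hM, fun a b => ?_⟩
  have hlim : Tendsto (fun i : ℕ => shapeDist (matrixShape (S i) k) L + ((i : ENNReal) + 1)⁻¹)
      atTop (𝓝 0) := by
    have h : Tendsto (fun i : ℕ => ((i : ENNReal) + 1)⁻¹) atTop (𝓝 0) := by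
      have := (tendsto_add_atTop_iff_nat 1).2 ENNReal.tendsto_inv_nat_nhds_zero
      simpa using this
    simpa using hL.2.add h
  have hdist : Tendsto (fun i => dist (toL1 X) (toL1 (M i * S i * (M i).transpose)))
      atTop (𝓝 0) := by
    have := tendsto_of_tendsto_of_tendsto_of_le_of_le tendsto_const_nhds hlim
      (fun _ => zero_le) hd
    simpa [Function.comp_def, edist_dist] using
      (ENNReal.tendsto_toReal ENNReal.zero_ne_top).comp this
  rw [tendsto_iff_dist_tendsto_zero]
  refine squeeze_zero (fun _ => dist_nonneg) (fun i => ?_) hdist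
  rw [dist_comm, Real.dist_eq]
  exact abs_entry_sub_le_dist _ _ a b

/-! ### Shapes of a weak limit -/

section WeakLimit

variable {Y : Type*} [MeasurableSpace Y]

lemma abs_integral_mul_sub_le (μ : Measure (Y × Y)) [IsFiniteMeasure μ] {ρ : Measure Y}
    [IsFiniteMeasure ρ] (h1 : μ.map Prod.fst ≤ ρ) (h2 : μ.map Prod.snd ≤ ρ) {k : ℕ}
    {g h : Fin k → Y → ℝ} (hgm : ∀ a, Measurable (g a)) (hhm : ∀ a, Measurable (h a))
    (hg0 : ∀ a y, 0 ≤ g a y) (hg1 : ∀ a y, g a y ≤ 1)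
    (hh0 : ∀ a y, 0 ≤ h a y) (hh1 : ∀ a y, h a y ≤ 1) {δ : ℝ}
    (hδ : ∀ a, ∫ y, |g a y - h a y| ∂ρ ≤ δ) (a b : Fin k) :
    |∫ q, g a q.1 * g b q.2 ∂μ - ∫ q, h a q.1 * h b q.2 ∂μ| ≤ 2 * δ := by
  have hprod (u : Fin k → Y → ℝ) (hum : ∀ a, Measurable (u a)) (hu0 : ∀ a y, 0 ≤ u a y)
      (hu1 : ∀ a y, u a y ≤ 1) : Integrable (fun q : Y × Y => u a q.1 * u b q.2) μ := by
    have hm : Measurable fun q : Y × Y => u a q.1 * u b q.2 :=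
      ((hum a).comp measurable_fst).mul ((hum b).comp measurable_snd)
    refine Integrable.of_bound hm.aestronglyMeasurable 1 (Eventually.of_forall fun q => ?_)
    rw [Real.norm_eq_abs, abs_of_nonneg (mul_nonneg (hu0 _ _) (hu0 _ _))]
    exact mul_le_one₀ (hu1 _ _) (hu0 _ _) (hu1 _ _)
  have hdm (a) : Measurable fun y => |g a y - h a y| := ((hgm a).sub (hhm a)).abs
  have hdb (a) (y) : ‖|g a y - h a y|‖ ≤ 1 := by
    rw [Real.norm_eq_abs, abs_abs]
    exact abs_le.2 ⟨by linarith [hg0 a y, hh1 a y], by linarith [hg1 a y, hh0 a y]⟩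
  have hdi (a) : Integrable (fun y => |g a y - h a y|) ρ :=
    Integrable.of_bound (hdm a).aestronglyMeasurable 1 (Eventually.of_forall (hdb a))
  have hmarg (a) (π : Y × Y → Y) (hπ : Measurable π) (hπρ : μ.map π ≤ ρ) :
      ∫ q, |g a (π q) - h a (π q)| ∂μ ≤ δ := by
    rw [← integral_map (f := fun y => |g a y - h a y|) hπ.aemeasurable
      (hdm a).aestronglyMeasurable]
    exact (integral_mono_measure hπρ (Eventually.of_forall fun y => abs_nonneg _)
      (hdi a)).trans (hδ a)
  have hi (a) (π : Y × Y → Y) (hπ : Measurable π) :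
      Integrable (fun q => |g a (π q) - h a (π q)|) μ :=
    Integrable.of_bound ((hdm a).comp hπ).aestronglyMeasurable 1
      (Eventually.of_forall fun q => hdb a (π q))
  rw [← integral_sub (hprod g hgm hg0 hg1) (hprod h hhm hh0 hh1)]
  calc |∫ q, (g a q.1 * g b q.2 - h a q.1 * h b q.2) ∂μ|
      ≤ ∫ q, |g a q.1 * g b q.2 - h a q.1 * h b q.2| ∂μ := abs_integral_le_integral_abs
    _ ≤ ∫ q, (|g a q.1 - h a q.1| + |g b q.2 - h b q.2|) ∂μ := by
        refine integral_mono_of_nonneg (Eventually.of_forall fun q => abs_nonneg _)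
          ((hi a _ measurable_fst).add (hi b _ measurable_snd)) (Eventually.of_forall fun q => ?_)
        exact abs_mul_sub_mul_le (hg0 _ _) (hg1 _ _) (hh0 _ _) (hh1 _ _)
    _ ≤ 2 * δ := by
        rw [integral_add (hi a _ measurable_fst) (hi b _ measurable_snd)]
        linarith [hmarg a _ measurable_fst h1, hmarg b _ measurable_snd h2]

variable [TopologicalSpace Y] [CompactSpace Y] [TopologicalSpace.MetrizableSpace Y]
  [SecondCountableTopology Y] [BorelSpace Y]

/-- Every matrix of a weak limit of the measures of the `S i` lies in the limit of their shapes.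
The partition is approximated by a continuous one simultaneously for the base measure and the
marginals of the limit, since the latter need not be absolutely continuous; the continuous partition
is then pulled back to the index sets and rounded. -/
theorem pairingMatrix_mem_of_weak_limit {n : ℕ → ℕ} (S : ∀ i, Matrix (Fin (n i)) (Fin (n i)) ℝ)
    (hS : ∀ i x y, 0 ≤ S i x y) {c : ℝ} (hc : ∀ i, entrySum (S i) ≤ c)
    (p : Y) (Φ : ∀ i, Fin (n i) → Y) (U : Ultrafilter ℕ)
    (m : Measure Y) [IsFiniteMeasure m] (μ : Measure (Y × Y)) [IsFiniteMeasure μ]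
    (hm : ∀ f : Y → ℝ, Continuous f →
      Tendsto (fun i => ∫ y, f y ∂empiricalMeasure p (Φ i)) U (𝓝 (∫ y, f y ∂m)))
    (hμ : ∀ f : Y × Y → ℝ, Continuous f →
      Tendsto (fun i => ∫ q, f q ∂weightMeasure (S i) (Φ i)) U (𝓝 (∫ q, f q ∂μ)))
    {k : ℕ} (hk : k ≠ 0) {L : Set (Matrix (Fin k) (Fin k) ℝ)} (hLc : IsClosed L)
    (hL : ∀ η : ℝ, 0 < η → ∀ᶠ i in U, ∀ X ∈ matrixShape (S i) k,
      ∃ X' ∈ L, ∀ a b, |X a b - X' a b| ≤ η)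
    {g : Fin k → Y → ℝ} (hg : IsBalancedPartition m g) : pairingMatrix μ g ∈ L := by
  obtain ⟨hgm, hg0, hg1, hgint⟩ := hg
  have hgle (a y) : g a y ≤ 1 := le_one_of_sum_eq_one (fun a => hg0 a y) (hg1 y) a
  have hc0 : 0 ≤ c :=
    (Finset.sum_nonneg fun x _ => Finset.sum_nonneg fun y _ => hS 0 x y).trans (hc 0)
  have hk0 : (0 : ℝ) < k := by positivity
  suffices happ : ∀ ε : ℝ, 0 < ε → ∃ X' ∈ L, ∀ a b, |pairingMatrix μ g a b - X' a b| ≤ ε by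
    have hcl : (show Fin k → Fin k → ℝ from pairingMatrix μ g) ∈
        closure (show Set (Fin k → Fin k → ℝ) from L) := by
      refine Metric.mem_closure_iff.2 fun ε hε => ?_
      obtain ⟨X', hX', h⟩ := happ (ε / 2) (by linarith)
      refine ⟨X', hX', lt_of_le_of_lt ?_ (half_lt_self hε)⟩
      exact (dist_pi_le_iff (by linarith)).2 fun a => (dist_pi_le_iff (by linarith)).2 fun b =>
        h a b
    exact hLc.closure_eq ▸ hcl
  intro ε hε
  -- The bounds below add up to `4 * δ + 4 * k * c * δ`, and rounding needs `2 * k * δ ≤ 1`.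
  obtain ⟨δ, hδ0, hδk, hδε⟩ : ∃ δ : ℝ, 0 < δ ∧ 2 * k * δ ≤ 1 ∧ δ * (4 + 4 * k * c) ≤ ε := by
    have hd : 0 < 4 + 4 * k * c := by positivity
    refine ⟨min (ε / (4 + 4 * k * c)) (1 / (2 * k)), by positivity, ?_, ?_⟩
    · calc 2 * k * min (ε / (4 + 4 * k * c)) (1 / (2 * k)) ≤ 2 * k * (1 / (2 * k)) := by
            gcongr
            exact min_le_right _ _
        _ = 1 := by field_simp
    · calc min (ε / (4 + 4 * k * c)) (1 / (2 * k)) * (4 + 4 * k * c)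
          ≤ ε / (4 + 4 * k * c) * (4 + 4 * k * c) := by
            gcongr
            exact min_le_left _ _
        _ = ε := by field_simp
  -- One measure that controls both the balance condition and the two variables of `μ`.
  let ρ : Measure Y := m + (μ.map Prod.fst + μ.map Prod.snd)
  obtain ⟨h, hhc, hh0, hh1, hhδ⟩ :=
    exists_continuous_partition_integral_sub_le ρ hk g hgm hg0 hg1 hδ0
  have hhle (a y) : h a y ≤ 1 := le_one_of_sum_eq_one (fun a => hh0 a y) (hh1 y) a
  have hmean (a) : |∫ y, h a y ∂m - 1 / k| ≤ δ := by
    have hint (u : Y → ℝ) (hu : Measurable u) (hu0 : ∀ y, 0 ≤ u y) (hu1 : ∀ y, u y ≤ 1)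
        (θ : Measure Y) [IsFiniteMeasure θ] : Integrable u θ :=
      Integrable.of_bound hu.aestronglyMeasurable 1 (Eventually.of_forall fun y => by
        rw [Real.norm_eq_abs, abs_of_nonneg (hu0 y)]; exact hu1 y)
    rw [← hgint a, abs_sub_comm, ← integral_sub (hint _ (hgm a) (hg0 a) (hgle a) m)
      (hint _ (hhc a).measurable (hh0 a) (hhle a) m)]
    refine abs_integral_le_integral_abs.trans (le_trans ?_ (hhδ a))
    refine integral_mono_measure (Measure.le_add_right le_rfl)
      (Eventually.of_forall fun y => abs_nonneg _) ?_
    exact ((hint _ (hgm a) (hg0 a) (hgle a) ρ).sub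
      (hint _ (hhc a).measurable (hh0 a) (hhle a) ρ)).abs
  have hmat (a b) : |∫ q, g a q.1 * g b q.2 ∂μ - ∫ q, h a q.1 * h b q.2 ∂μ| ≤ 2 * δ :=
    abs_integral_mul_sub_le μ
      ((Measure.le_add_right le_rfl).trans (Measure.le_add_left le_rfl))
      ((Measure.le_add_left le_rfl).trans (Measure.le_add_left le_rfl))
      hgm (fun a => (hhc a).measurable) hg0 hgle hh0 hhle hhδ a b
  have ev1 : ∀ᶠ i in U, ∀ a,
      |∫ y, h a y ∂empiricalMeasure p (Φ i) - ∫ y, h a y ∂m| < δ :=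
    eventually_all.2 fun a => (Metric.tendsto_nhds.1 (hm _ (hhc a)) δ hδ0)
  have ev2 : ∀ᶠ i in U, ∀ a b, |∫ q, h a q.1 * h b q.2 ∂weightMeasure (S i) (Φ i) -
      ∫ q, h a q.1 * h b q.2 ∂μ| < δ :=
    eventually_all.2 fun a => eventually_all.2 fun b => Metric.tendsto_nhds.1
      (hμ _ (((hhc a).comp continuous_fst).mul ((hhc b).comp continuous_snd))) δ hδ0
  obtain ⟨i, hi1, hi2, hi3⟩ := (ev1.and (ev2.and (hL δ hδ0))).exists
  obtain ⟨M, hM, hMh⟩ := exists_fractionalPartition_near hk (t := 2 * k * δ) (by positivity) hδk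
    (fun a x => h a (Φ i x)) (fun a x => hh0 a _) (fun x => hh1 _) (fun a hn => by
      have h1 := hi1 a
      rw [integral_empiricalMeasure p (Φ i) hn (hhc a).measurable] at h1
      rw [show 2 * k * δ / k = δ + δ by field_simp; ring]
      exact (abs_sub_le _ _ _).trans (add_le_add h1.le (hmean a)))
  obtain ⟨X', hX', hXX'⟩ := hi3 _ ⟨M, hM, rfl⟩
  refine ⟨X', hX', fun a b => ?_⟩
  have e1 := hmat a b
  have e2 := (hi2 a b).le
  have e3 := hXX' a b
  have hhm : Measurable fun q : Y × Y => h a q.1 * h b q.2 :=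
    ((hhc a).measurable.comp measurable_fst).mul ((hhc b).measurable.comp measurable_snd)
  rw [integral_weightMeasure (S i) (hS i) (Φ i) hhm] at e2
  rw [mul_mul_transpose_apply] at e3
  have e4 := abs_sum_weights_sub_le (S i) (hS i) M (fun a x => h a (Φ i x)) hM.1
    (fractionalPartitions_le_one hM) (fun a x => hh0 a _) (fun a x => hhle a _) hMh a b
  have e5 : 2 * (2 * k * δ) * entrySum (S i) ≤ 2 * (2 * k * δ) * c :=
    mul_le_mul_of_nonneg_left (hc i) (by positivity)
  have e6 : δ * (4 + 4 * k * c) = 2 * δ + δ + 2 * (2 * k * δ) * c + δ := by ring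
  simp only [pairingMatrix, Matrix.of_apply]
  rw [abs_le] at e1 e2 e3 e4 ⊢
  constructor <;> linarith

end WeakLimit

/-! ### The universal space of column vectors -/

/-- A point records, for each `p = (k, d)`, a point of the simplex with `k + 1` vertices: the column
of an index in the `d`-th of countably many fractional partitions into `k + 1` parts. The shift by
one keeps all factors nonempty. -/
abbrev ColumnSpace : Type := ∀ p : ℕ × ℕ, stdSimplex ℝ (Fin (p.1 + 1))

instance (k : ℕ) : PolishSpace (stdSimplex ℝ (Fin k)) :=
  (isCompact_stdSimplex ℝ (Fin k)).isClosed.polishSpace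

/-- The `a`-th coordinate of the `p`-th column. -/
def columnCoord (p : ℕ × ℕ) (a : Fin (p.1 + 1)) (z : ColumnSpace) : ℝ := (z p).1 a

lemma continuous_columnCoord (p : ℕ × ℕ) (a : Fin (p.1 + 1)) : Continuous (columnCoord p a) :=
  (continuous_apply a).comp (continuous_subtype_val.comp (continuous_apply p))

/-- The point all of whose columns are uniform. It stands in for the missing indices of a `0 × 0`
matrix. -/
def uniformColumns : ColumnSpace := fun p =>
  ⟨fun _ => 1 / ((p.1 + 1 : ℕ) : ℝ), fun _ => by positivity, by
    have : ((p.1 + 1 : ℕ) : ℝ) ≠ 0 := Nat.cast_ne_zero.2 p.1.succ_ne_zero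
    simp only [Finset.sum_const, Finset.card_univ, Fintype.card_fin, nsmul_eq_mul]
    field_simp⟩

/-- The map sending an index to its columns in a family of balanced fractional partitions. -/
def columnMap {n : ℕ} (M : ∀ p : ℕ × ℕ, Matrix (Fin (p.1 + 1)) (Fin n) ℝ)
    (hM : ∀ p, M p ∈ fractionalPartitions (p.1 + 1) n) (x : Fin n) : ColumnSpace :=
  fun p => ⟨fun a => M p a x, fun a => (hM p).1 a x, (hM p).2.2 x⟩

lemma integral_columnCoord_empiricalMeasure {n : ℕ}
    (M : ∀ p : ℕ × ℕ, Matrix (Fin (p.1 + 1)) (Fin n) ℝ)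
    (hM : ∀ p, M p ∈ fractionalPartitions (p.1 + 1) n) (p : ℕ × ℕ) (a : Fin (p.1 + 1)) :
    ∫ z, columnCoord p a z ∂empiricalMeasure uniformColumns (columnMap M hM) =
      1 / ((p.1 + 1 : ℕ) : ℝ) := by
  have hmeas := (continuous_columnCoord p a).measurable
  rcases eq_or_ne n 0 with rfl | hn
  · rw [empiricalMeasure, if_pos rfl, integral_dirac' _ _ hmeas.stronglyMeasurable]
    rfl
  · have hn' : (n : ℝ) ≠ 0 := Nat.cast_ne_zero.2 hn
    rw [integral_empiricalMeasure _ _ hn hmeas]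
    have hrow : ∑ x, columnCoord p a (columnMap M hM x) = n / ((p.1 + 1 : ℕ) : ℝ) :=
      (hM p).2.1 a
    rw [hrow]
    field_simp

end SparseShape

end

open SparseShape in
theorem mainTheorem1 (n : ℕ → ℕ) (S : ∀ i, Matrix (Fin (n i)) (Fin (n i)) ℝ)
    (hnonneg : ∀ i x y, 0 ≤ S i x y) (hsymm : ∀ i, (S i).IsSymm)
    (hconv : SparseShape.ShapeConvergent S) :
    ∃ μ : Measure (SparseShape.Cantor × SparseShape.Cantor),
      IsFiniteMeasure μ ∧ μ.map Prod.swap = μ ∧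
        ∀ k : ℕ, 1 ≤ k → SparseShape.IsLimitShape S k (SparseShape.measureShape μ k) := by
  obtain ⟨c, -, hc, hL⟩ := hconv
  choose L hL using fun k : ℕ => hL (k + 1) k.succ_pos
  have hLim (k) : IsLimitShape S (k + 1) (L k) := (hL k).2
  -- A dense sequence of each limit shape, each member realized along the given matrices.
  have hdense (k) : ∃ X : ℕ → Matrix (Fin (k + 1)) (Fin (k + 1)) ℝ,
      (∀ d, X d ∈ L k) ∧ L k ⊆ closure (Set.range X) := by
    have hne : (L k).Nonempty := by
      obtain ⟨i, hi⟩ := (eventually_exists_mem_limitShape (hLim k) one_pos).exists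
      obtain ⟨X, hX⟩ := matrixShape_nonempty (S i) k.succ_ne_zero
      obtain ⟨X', hX', -⟩ := hi X hX
      exact ⟨X', hX'⟩
    let T : Set (Fin (k + 1) → Fin (k + 1) → ℝ) := L k
    have : Nonempty T := hne.to_subtype
    refine ⟨fun d => (TopologicalSpace.denseSeq T d).1,
      fun d => (TopologicalSpace.denseSeq T d).2, fun X hX => ?_⟩
    have h := TopologicalSpace.denseRange_denseSeq T ⟨X, hX⟩
    have h2 := image_closure_subset_closure_image
      (continuous_subtype_val (p := fun x => x ∈ T)) (Set.mem_image_of_mem _ h)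
    rw [← Set.range_comp] at h2
    exact h2
  choose X hXL hXdense using hdense
  choose M hM hMX using fun p : ℕ × ℕ =>
    exists_tendsto_of_mem_limitShape p.1.succ_ne_zero (hLim p.1) (hXL p.1 p.2)
  let Φ (i : ℕ) : Fin (n i) → ColumnSpace := columnMap (fun p => M p i) (fun p => hM p i)
  let U : Ultrafilter ℕ := hyperfilter ℕ
  have hU : (U : Filter ℕ) ≤ atTop := Nat.hyperfilter_le_atTop
  obtain ⟨m, hmfin, hm⟩ := exists_weak_limit
    (fun i => empiricalMeasure uniformColumns (Φ i)) (C := 1) (fun i => by simp) U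
  obtain ⟨μ', hμfin, hμ⟩ := exists_weak_limit (fun i => weightMeasure (S i) (Φ i)) (C := c)
    (fun i => (weightMeasure_real_univ (S i) (hnonneg i) (Φ i)).trans_le (hc i).le) U
  have hmprob : IsProbabilityMeasure m := by
    have h := hm (fun _ => 1) continuous_const
    simp only [integral_const, probReal_univ, smul_eq_mul, mul_one] at h
    exact ⟨by rw [← ENNReal.toReal_eq_one_iff]; exact (tendsto_nhds_unique h tendsto_const_nhds)⟩
  have hswap : μ'.map Prod.swap = μ' := by
    refine ext_of_forall_integral_eq_of_IsFiniteMeasure fun f => ?_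
    rw [integral_map measurable_swap.aemeasurable f.continuous.measurable.aestronglyMeasurable]
    refine tendsto_nhds_unique (hμ _ (f.continuous.comp continuous_swap)) ?_
    refine (hμ _ f.continuous).congr fun i => ?_
    conv_lhs => rw [← map_swap_weightMeasure (S i) (hsymm i) (Φ i)]
    exact integral_map measurable_swap.aemeasurable f.continuous.measurable.aestronglyMeasurable
  obtain ⟨μ, hμfin', hμswap, hshape⟩ := exists_measure_cantor_pairingMatrix_iff m μ' hswap
  refine ⟨μ, hμfin', hμswap, fun k hk => ?_⟩
  obtain ⟨k, rfl⟩ : ∃ j, k = j + 1 := ⟨k - 1, by omega⟩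
  suffices h : measureShape μ (k + 1) = L k by rw [h]; exact hLim k
  refine Set.Subset.antisymm (closure_minimal ?_ (hLim k).1) ?_
  · intro Z hZ
    obtain ⟨g, hg, rfl⟩ := (hshape (k + 1) Z).1 hZ
    exact pairingMatrix_mem_of_weak_limit S hnonneg (fun i => (hc i).le) uniformColumns Φ U m μ'
      hm hμ k.succ_ne_zero (hLim k).1
      (fun η hη => hU (eventually_exists_mem_limitShape (hLim k) hη)) hg
  · refine (hXdense k).trans (closure_mono ?_)
    rintro _ ⟨d, rfl⟩
    refine (hshape (k + 1) (X k d)).2 ⟨columnCoord (k, d),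
      ⟨fun a => (continuous_columnCoord (k, d) a).measurable, fun a z => (z (k, d)).2.1 a,
        fun z => (z (k, d)).2.2, fun a => ?_⟩, ?_⟩
    · have h := hm _ (continuous_columnCoord (k, d) a)
      simp only [Φ, integral_columnCoord_empiricalMeasure] at h
      exact tendsto_nhds_unique h tendsto_const_nhds
    · ext a b
      have hcont : Continuous fun q : ColumnSpace × ColumnSpace =>
          columnCoord (k, d) a q.1 * columnCoord (k, d) b q.2 :=
        ((continuous_columnCoord (k, d) a).comp continuous_fst).mul
          ((continuous_columnCoord (k, d) b).comp continuous_snd)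
      refine tendsto_nhds_unique ((hMX (k, d) a b).mono_left hU) ((hμ _ hcont).congr fun i => ?_)
      rw [integral_weightMeasure (S i) (hnonneg i) (Φ i) hcont.measurable,
        mul_mul_transpose_apply]
      rfl
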